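/- For a positive integer $n$, let $n$ coins weighing $1, 2, \ldots, n$ grams be given. Suppose that Baron Münchhausen knows which coin weighs how much, but his audience knows only that the weights are $1, 2, \ldots, n$ in some order. In a weighing on a balance scale the Baron puts some of the coins on the left cup and some other coins on the right cup, and the audience sees which coins are on which cup and whether the left cup is lighter than, as heavy as, or heavier than the right one. A sequence of weighings demonstrates the weight of a coin $c$ if all assignments of the weights $1, 2, \ldots, n$ to the coins that are consistent with all the observed outcomes give $c$ the same weight. Let $a(n)$ be the minimum number of weighings that the Baron must conduct in order to demonstrate the weight of at least one of the coins. Then $a(n) \le 3$ for every $n \ge 1$. -/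

import Mathlib

namespace Munchhausen

/-- An assignment of the weights `1, 2, …, n` grams to the `n` labelled coins `Fin n`, each weight
being used exactly once. The coin `c` weighs `σ c + 1` grams (see `weight`). -/
abbrev Arrangement (n : ℕ) : Type := Equiv.Perm (Fin n)

/-- The weight in grams of the coin `c` under the arrangement `σ`. -/
def weight {n : ℕ} (σ : Arrangement n) (c : Fin n) : ℕ := (σ c : ℕ) + 1

/-- A weighing on a balance scale: some coins go on the left cup, some other coins on the right cup,
the remaining ones stay off the scale. The cups need not hold equally many coins. (An empty
cup is allowed; such a weighing carries no information, so it does not influence the minimum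
number of weighings.) -/
structure Weighing (n : ℕ) where
  left : Finset (Fin n)
  right : Finset (Fin n)
  disjoint : Disjoint left right

/-- What the scale shows if the true weights are given by `σ`: `lt` when the left cup is lighter,
`eq` when the cups balance, `gt` when the left cup is heavier. -/
def Weighing.outcome {n : ℕ} (w : Weighing n) (σ : Arrangement n) : Ordering :=
  compare (∑ c ∈ w.left, weight σ c) (∑ c ∈ w.right, weight σ c)

/-- The weighings `w 0, …, w (m - 1)`, carried out when the true arrangement is `τ`, demonstrate
the weight of the coin `c`: every arrangement under which the scale shows the same outcomes
gives `c` the same weight. -/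
def Demonstrates {n m : ℕ} (τ : Arrangement n) (w : Fin m → Weighing n) (c : Fin n) : Prop :=
  ∀ σ : Arrangement n, (∀ i, (w i).outcome σ = (w i).outcome τ) → weight σ c = weight τ c

/-- Whatever the true arrangement `τ` is, the Baron, who knows it, can choose `m` weighings
that demonstrate the weight of at least one coin. -/
def CanDemonstrate (n m : ℕ) : Prop :=
  ∀ τ : Arrangement n, ∃ w : Fin m → Weighing n, ∃ c : Fin n, Demonstrates τ w c

/-- Baron Münchhausen's sequence: the minimum number of weighings that suffice to demonstrate the
weight of at least one of `n` coins (the infimum is `⊤` if no number suffices). -/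
noncomputable def a (n : ℕ) : ℕ∞ := ⨅ (m : ℕ) (_ : CanDemonstrate n m), (m : ℕ∞)

end Munchhausen

namespace Munchhausen

/-! ### Positive definite integral forms and sums of three squares -/

/-! By Gauss, `n = T_a + T_b + T_c` with triangular numbers and `a ≥ b ≥ c`. The Baron balances the
`a` lightest coins against coin `T_a`, then that coin and the `b` lightest against coin `T_a + T_b`,
then that one and the `c` lightest against coin `n`. Since `k` distinct positive weights total at
least `T_k`, the three balances force the last coin to weigh at least `n`, hence exactly `n`. Only
`n ≤ 3` needs separate care.

Gauss's theorem comes from writing `8n + 3` as a sum of three squares, necessarily odd. For this,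
Dirichlet's theorem and quadratic reciprocity produce a positive definite ternary form of
determinant 1 representing `8n + 3`, and reduction theory shows that every such form is equivalent
to `x² + y² + z²`. -/

lemma exists_abs_add_mul_le (b : ℤ) {a : ℤ} (ha : 0 < a) :
    ∃ k : ℤ, 4 * (b + k * a) ^ 2 ≤ a ^ 2 := by
  refine ⟨-((2 * b + a) / (2 * a)), ?_⟩
  have h1 := Int.mul_ediv_add_emod (2 * b + a) (2 * a)
  have h2 := Int.emod_nonneg (2 * b + a) (by omega : 2 * a ≠ 0)
  have h3 := Int.emod_lt_of_pos (2 * b + a) (by omega : 0 < 2 * a)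
  generalize (2 * b + a) / (2 * a) = k at *
  generalize (2 * b + a) % (2 * a) = e at *
  nlinarith

lemma pos_of_det_pos {a b c : ℤ} (ha : 0 < a) (h : 0 < a * c - b ^ 2) : 0 < c :=
  pos_of_mul_pos_right (by nlinarith [sq_nonneg b] : 0 < a * c) ha.le

/-- A positive definite binary form of determinant `d` takes a value of size at most `√(4d/3)` at
some primitive vector. -/
lemma exists_coprime_binary_value_le (n : ℕ) : ∀ a b c d : ℤ, a.toNat ≤ n → 0 < a → 0 < d →
    a * c - b ^ 2 = d → ∃ p r : ℤ, IsCoprime p r ∧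
      0 < a * p ^ 2 + 2 * b * p * r + c * r ^ 2 ∧
      3 * (a * p ^ 2 + 2 * b * p * r + c * r ^ 2) ^ 2 ≤ 4 * d := by
  induction n with
  | zero => intro a b c d h ha; omega
  | succ n ih =>
    intro a b c d h ha hd hdet
    obtain ⟨k, hk⟩ := exists_abs_add_mul_le b ha
    set b' := b + k * a with hb'
    set c' := a * k ^ 2 + 2 * b * k + c with hc'
    have hdet' : a * c' - b' ^ 2 = d := by rw [hb', hc', ← hdet]; ring
    have hc'pos : 0 < c' := pos_of_det_pos ha (by rwa [hdet'])
    rcases le_or_gt a c' with hle | hlt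
    · refine ⟨1, 0, isCoprime_one_left, by simpa using ha, ?_⟩
      have : a * a ≤ a * c' := mul_le_mul_of_nonneg_left hle ha.le
      nlinarith
    · obtain ⟨p, r, hpr, hpos, hle⟩ := ih c' b' a d (by omega) hc'pos hd (by linarith)
      have heq : a * (r + k * p) ^ 2 + 2 * b * (r + k * p) * p + c * p ^ 2
          = c' * p ^ 2 + 2 * b' * p * r + a * r ^ 2 := by
        rw [hb', hc']; ring
      refine ⟨r + k * p, p, ?_, ?_, ?_⟩
      · exact (IsCoprime.add_mul_right_left_iff).2 hpr.symm
      · rw [heq]; exact hpos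
      · rw [heq]; exact hle

/-- The ternary quadratic form with diagonal coefficients `a, b, c` and off-diagonal half
coefficients `p, q, r`. -/
def ternaryForm (a b c p q r x y z : ℤ) : ℤ :=
  a * x ^ 2 + b * y ^ 2 + c * z ^ 2 + 2 * p * y * z + 2 * q * x * z + 2 * r * x * y

lemma ternaryForm_one_one_eq {c p q : ℤ} (hdet : c - p ^ 2 - q ^ 2 = 1) (x y z : ℤ) :
    ternaryForm 1 1 c p q 0 x y z = (x + q * z) ^ 2 + (y + p * z) ^ 2 + z ^ 2 := by
  obtain rfl : c = 1 + p ^ 2 + q ^ 2 := by linarith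
  unfold ternaryForm; ring

/-- Reducedness gives `3a² ≤ 4d`; together with `3d² ≤ 4a` this yields `27a³ ≤ 64`, so `a < 2`. -/
lemma le_one_of_reduced {a b r d : ℤ} (ha : 0 < a) (hab : a ≤ b) (hr : 4 * r ^ 2 ≤ a ^ 2)
    (hd : a * b - r ^ 2 = d) (hda : 3 * d ^ 2 ≤ 4 * a) : a = 1 := by
  have h1 : a * a ≤ a * b := mul_le_mul_of_nonneg_left hab ha.le
  have h2 : 3 * a ^ 2 ≤ 4 * d := by nlinarith
  by_contra hne
  have h3 : 2 ≤ a := by omega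
  have h4 : (3 * a ^ 2) ^ 2 ≤ (4 * d) ^ 2 := pow_le_pow_left₀ (by positivity) h2 2
  have h5 : 27 * a ^ 3 * a ≤ 64 * a := by nlinarith
  have h6 : 27 * a ^ 3 ≤ 64 := le_of_mul_le_mul_right h5 ha
  have h7 : (2 : ℤ) ^ 3 ≤ a ^ 3 := pow_le_pow_left₀ (by norm_num) h3 3
  linarith

/-- Every value of a positive definite integral ternary form of determinant one is a sum of three
squares. -/
lemma ternaryForm_eq_sum_three_sq (n : ℕ) : ∀ a b c p q r : ℤ, a.toNat ≤ n → 0 < a →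
    0 < a * b - r ^ 2 →
    a * b * c + 2 * p * q * r - a * p ^ 2 - b * q ^ 2 - c * r ^ 2 = 1 →
    ∀ x y z : ℤ, ∃ u v w : ℤ, ternaryForm a b c p q r x y z = u ^ 2 + v ^ 2 + w ^ 2 := by
  induction n with
  | zero => intro a b c p q r h ha; omega
  | succ n ih =>
    intro a b c p q r h ha hmin hdet
    -- Completing the square, `a * f` is a square plus this binary form in `y, z`, of determinant
    -- `a`. Its small primitive vector is completed to the basis `(1,0,0)`, `(k,α,γ)`, `(0,-β,δ)` of
    -- determinant 1; the primed letters are the coefficients of `f` in it.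
    obtain ⟨α, γ, ⟨δ, β, hβδ⟩, hpos, hsmall⟩ := exists_coprime_binary_value_le _
      (a * b - r ^ 2) (a * p - q * r) (a * c - q ^ 2) a le_rfl hmin ha
      (by linear_combination a * hdet)
    obtain ⟨k, hk⟩ := exists_abs_add_mul_le (r * α + q * γ) ha
    obtain ⟨b', hb'⟩ : ∃ b', b' = a * k ^ 2 + b * α ^ 2 + c * γ ^ 2 + 2 * p * α * γ +
      2 * q * k * γ + 2 * r * k * α := ⟨_, rfl⟩
    obtain ⟨c', hc'⟩ : ∃ c', c' = b * β ^ 2 + c * δ ^ 2 - 2 * p * β * δ := ⟨_, rfl⟩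
    obtain ⟨r', hr'⟩ : ∃ r', r' = r * α + q * γ + k * a := ⟨_, rfl⟩
    obtain ⟨q', hq'⟩ : ∃ q', q' = - r * β + q * δ := ⟨_, rfl⟩
    obtain ⟨p', hp'⟩ : ∃ p', p' = k * (- r * β + q * δ) - b * α * β + c * γ * δ +
      p * (α * δ - β * γ) := ⟨_, rfl⟩
    have hmin' : a * b' - r' ^ 2 = (a * b - r ^ 2) * α ^ 2 + 2 * (a * p - q * r) * α * γ +
        (a * c - q ^ 2) * γ ^ 2 := by rw [hb', hr']; ring
    rw [← hmin'] at hpos hsmall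
    rw [← hr'] at hk
    have hdet' : a * b' * c' + 2 * p' * q' * r' - a * p' ^ 2 - b' * q' ^ 2 - c' * r' ^ 2 = 1 := by
      have : a * b' * c' + 2 * p' * q' * r' - a * p' ^ 2 - b' * q' ^ 2 - c' * r' ^ 2 =
          (δ * α + β * γ) ^ 2 *
            (a * b * c + 2 * p * q * r - a * p ^ 2 - b * q ^ 2 - c * r ^ 2) := by
        rw [hb', hc', hr', hq', hp']; ring
      rw [this, hβδ, hdet]; norm_num
    have key : ∀ x y z : ℤ, ∃ u v w : ℤ,
        ternaryForm a b' c' p' q' r' x y z = u ^ 2 + v ^ 2 + w ^ 2 := by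
      -- Either the first two variables are reduced, which forces `a = b' = 1` and `r' = 0`, or
      -- swapping them lowers the leading coefficient.
      rcases le_or_gt a b' with hle | hlt
      · obtain rfl := le_one_of_reduced ha hle hk rfl hsmall
        have hr0 : r' = 0 := by
          by_contra hne
          have := Int.one_le_abs hne
          nlinarith [sq_abs r']
        have hb1 : b' = 1 := by
          rw [hr0] at hsmall
          nlinarith
        intro x y z
        rw [hr0, hb1] at hdet' ⊢
        exact ⟨_, _, _, ternaryForm_one_one_eq (by linarith) x y z⟩
      · intro x y z
        have hb0 : 0 < b' := pos_of_det_pos ha hpos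
        obtain ⟨u, v, w, huvw⟩ := ih b' a c' q' p' r' (by omega) hb0
          (by linear_combination hpos) (by linear_combination hdet')
          y x z
        exact ⟨u, v, w, by rw [← huvw]; unfold ternaryForm; ring⟩
    intro x y z
    obtain ⟨u, v, w, huvw⟩ := key (x - k * (δ * y + β * z)) (δ * y + β * z) (-γ * y + α * z)
    refine ⟨u, v, w, ?_⟩
    rw [← huvw]
    have hy : y = α * (δ * y + β * z) - β * (-γ * y + α * z) := by linear_combination -y * hβδ
    have hz : z = γ * (δ * y + β * z) + δ * (-γ * y + α * z) := by linear_combination -z * hβδ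
    generalize δ * y + β * z = y' at *
    generalize -γ * y + α * z = z' at *
    rw [hy, hz, hb', hc', hr', hq', hp']
    unfold ternaryForm
    ring

/-- If `-d` is a square modulo `d * m - 1`, then `m` is a sum of three squares. -/
lemma eq_sum_three_sq_of_dvd {m d s : ℤ} (hd : 0 < d) (hdm : 0 < d * m - 1)
    (h : d * m - 1 ∣ s ^ 2 + d) : ∃ u v w : ℤ, m = u ^ 2 + v ^ 2 + w ^ 2 := by
  obtain ⟨t, ht⟩ := h
  have ht0 : 0 < t := by
    have : 0 < (d * m - 1) * t := by rw [← ht]; positivity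
    exact pos_of_mul_pos_right this hdm.le
  -- From `s² + d = (dm - 1)t`, the leading minor is `d` and the determinant is 1; the value at
  -- `(0,0,1)` is `m`.
  obtain ⟨u, v, w, huvw⟩ := ternaryForm_eq_sum_three_sq _ t (d * m - 1) m 0 1 s le_rfl ht0
    (by linarith) (by linear_combination (-m) * ht) 0 0 1
  exact ⟨u, v, w, by rw [← huvw]; simp [ternaryForm]⟩

/-! ### Reciprocity, Dirichlet's theorem and three squares -/

open scoped NumberTheorySymbols in
-- With `d = 8j + 1` and `p ≡ 1 (mod 4)`, the symbols `(-d/p)`, `(d/p)` and `(p/d)` agree. The last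
-- is 1 because `-2p ≡ 1 (mod d)` and `(-2/d) = 1`.
lemma isSquare_neg_of_two_mul_prime {p m j : ℕ} (hp : p.Prime) (hp4 : p % 4 = 1)
    (h : 2 * p + 1 = (8 * j + 1) * m) : IsSquare ((-(8 * j + 1 : ℤ) : ℤ) : ZMod p) := by
  have := Fact.mk hp
  have hodd : Odd p := Nat.odd_iff.2 (by omega)
  have hdodd : Odd (8 * j + 1) := Nat.odd_iff.2 (by omega)
  apply ZMod.isSquare_of_jacobiSym_eq_one
  rw [jacobiSym.neg _ hodd, ZMod.χ₄_nat_one_mod_four hp4, one_mul]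
  have h1 : J(((8 * j + 1 : ℕ) : ℤ) | p) = J(p | 8 * j + 1) :=
    jacobiSym.quadratic_reciprocity_one_mod_four (by omega) hodd
  have h2 : J(-2 | 8 * j + 1) = 1 := by
    rw [jacobiSym.at_neg_two hdodd, ZMod.χ₈'_nat_eq_if_mod_eight]
    have e1 : (8 * j + 1) % 2 = 1 := by omega
    have e2 : (8 * j + 1) % 8 = 1 := by omega
    simp [e1, e2]
  have h3 : J(-2 * p | 8 * j + 1) = 1 := by
    rw [← jacobiSym.one_left (8 * j + 1)]
    apply jacobiSym.mod_left'
    apply Int.ModEq.symm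
    apply (Int.modEq_iff_dvd).2
    refine ⟨-m, ?_⟩
    have : (2 * p + 1 : ℤ) = (8 * j + 1) * m := by exact_mod_cast h
    push_cast
    linear_combination -this
  rw [jacobiSym.mul_left, h2, one_mul] at h3
  push_cast at h1
  rw [h1, h3]

/-- The case `m ≡ 3 (mod 8)` of the **three squares theorem**. -/
theorem eq_sum_three_sq_of_mod_eight_eq_three {m : ℕ} (hm : m % 8 = 3) :
    ∃ u v w : ℤ, (m : ℤ) = u ^ 2 + v ^ 2 + w ^ 2 := by
  obtain ⟨l, rfl⟩ : ∃ l, m = 2 * l + 1 := ⟨m / 2, by omega⟩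
  have hl4 : l % 4 = 1 := by omega
  have hcop : l.Coprime (4 * (2 * l + 1)) := by
    apply Nat.Coprime.mul_right
    · have : l.Coprime (2 ^ 2) := Nat.Coprime.pow_right 2 (Nat.coprime_two_right.2 (Nat.odd_iff.2 (by omega)))
      simpa using this
    · simp
  -- The class of `l` modulo `4m` makes `2p + 1` equal to `(8j + 1)m` and keeps `p ≡ 1 (mod 4)`, so
  -- `d = 8j + 1` has `dm - 1 = 2p`.
  obtain ⟨p, hpl, hp, hmod⟩ := Nat.forall_exists_prime_gt_and_modEq l (by omega) hcop
  obtain ⟨j, hj⟩ : ∃ j, p = l + 4 * (2 * l + 1) * j := by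
    obtain ⟨j, hj⟩ := (Nat.modEq_iff_dvd' hpl.le).1 hmod.symm
    exact ⟨j, by omega⟩
  have hp4 : p % 4 = 1 := by
    rw [hj, mul_assoc, Nat.add_mul_mod_self_left]; exact hl4
  have hpm : 2 * p + 1 = (8 * j + 1) * (2 * l + 1) := by rw [hj]; ring
  obtain ⟨s, hs⟩ := isSquare_neg_of_two_mul_prime hp hp4 hpm
  have := Fact.mk hp
  have hs' : (p : ℤ) ∣ (s.val : ℤ) ^ 2 + (8 * j + 1) := by
    rw [← ZMod.intCast_zmod_eq_zero_iff_dvd]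
    push_cast at hs ⊢
    rw [ZMod.natCast_zmod_val]
    linear_combination -hs
  -- An odd root modulo `p` also handles the factor 2 of the modulus `2p`.
  obtain ⟨t, ht2, htp⟩ : ∃ t : ℤ, t % 2 = 1 ∧ (p : ℤ) ∣ t ^ 2 + (8 * j + 1) := by
    rcases Int.emod_two_eq_zero_or_one (s.val : ℤ) with h | h
    · refine ⟨s.val + p, by omega, ?_⟩
      have : ((s.val : ℤ) + p) ^ 2 + (8 * j + 1) =
        ((s.val : ℤ) ^ 2 + (8 * j + 1)) + p * (2 * s.val + p) := by ring
      rw [this]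
      exact dvd_add hs' (dvd_mul_right _ _)
    · exact ⟨s.val, h, hs'⟩
  have h2 : (2 : ℤ) ∣ t ^ 2 + (8 * j + 1) := by
    obtain ⟨e, rfl⟩ : ∃ e, t = 2 * e + 1 := ⟨t / 2, by omega⟩
    exact ⟨2 * e ^ 2 + 2 * e + 4 * j + 1, by ring⟩
  have hpmz : (8 * j + 1 : ℤ) * ((2 * l + 1 : ℕ) : ℤ) - 1 = 2 * p := by
    have : (2 * p + 1 : ℤ) = (8 * j + 1) * (2 * l + 1) := by exact_mod_cast hpm
    push_cast; linarith
  have hp0 := hp.pos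
  refine eq_sum_three_sq_of_dvd (d := 8 * j + 1) (s := t) (by positivity)
    (by rw [hpmz]; positivity) ?_
  rw [hpmz]
  refine IsCoprime.mul_dvd ?_ h2 htp
  rw [Int.isCoprime_iff_gcd_eq_one]
  have : Nat.Coprime 2 p := Nat.coprime_two_left.2 (Nat.odd_iff.2 (by omega))
  exact_mod_cast this

/-- **Gauss's Eureka theorem**: every natural number is a sum of three triangular numbers. -/
theorem exists_triangular_sum_eq (n : ℕ) :
    ∃ a b c : ℕ, a * (a + 1) + b * (b + 1) + c * (c + 1) = 2 * n := by
  obtain ⟨u, v, w, h⟩ := eq_sum_three_sq_of_mod_eight_eq_three (m := 8 * n + 3) (by omega)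
  rw [← Int.natAbs_sq u, ← Int.natAbs_sq v, ← Int.natAbs_sq w] at h
  norm_cast at h
  generalize u.natAbs = x at h
  generalize v.natAbs = y at h
  generalize w.natAbs = z at h
  -- A sum of three squares is 3 modulo 4 only if all three are odd.
  have sq_mod (x : ℕ) : (x % 2 = 1 ∧ x ^ 2 % 4 = 1) ∨ (x % 2 = 0 ∧ x ^ 2 % 4 = 0) := by
    have : x % 4 = 0 ∨ x % 4 = 1 ∨ x % 4 = 2 ∨ x % 4 = 3 := by omega
    rcases this with h | h | h | h <;> simp [Nat.pow_mod, h] <;> omega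
  have hx := sq_mod x
  have hy := sq_mod y
  have hz := sq_mod z
  obtain ⟨a, rfl⟩ : ∃ a, x = 2 * a + 1 := ⟨x / 2, by omega⟩
  obtain ⟨b, rfl⟩ : ∃ b, y = 2 * b + 1 := ⟨y / 2, by omega⟩
  obtain ⟨c, rfl⟩ : ∃ c, z = 2 * c + 1 := ⟨z / 2, by omega⟩
  exact ⟨a, b, c, by linarith⟩

/-! ### Weighings that bound a weight from below -/

/-- The set of the `b` lightest coins. -/
def lightest {n : ℕ} (τ : Arrangement n) {b : ℕ} (hb : b ≤ n) : Finset (Fin n) :=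
  Finset.univ.map ((Fin.castLEEmb hb).trans τ.symm.toEmbedding)

lemma card_lightest {n : ℕ} (τ : Arrangement n) {b : ℕ} (hb : b ≤ n) :
    (lightest τ hb).card = b := by
  simp [lightest]

lemma weight_le_of_mem_lightest {n : ℕ} {τ : Arrangement n} {b : ℕ} {hb : b ≤ n} {c : Fin n}
    (hc : c ∈ lightest τ hb) : weight τ c ≤ b := by
  obtain ⟨i, -, rfl⟩ := Finset.mem_map.1 hc
  simp [weight]

lemma two_mul_sum_weight_lightest {n : ℕ} (τ : Arrangement n) {b : ℕ} (hb : b ≤ n) :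
    2 * ∑ c ∈ lightest τ hb, weight τ c = b * (b + 1) := by
  have h : ∑ c ∈ lightest τ hb, weight τ c = ∑ i ∈ Finset.range b, (i + 1) := by
    rw [lightest, Finset.sum_map, ← Fin.sum_univ_eq_sum_range (fun i => i + 1)]
    simp [weight]
  have h2 := Finset.sum_range_id_mul_two (b + 1)
  rw [Finset.sum_range_succ'] at h2
  rw [h]
  simp only [add_zero, Nat.add_sub_cancel] at h2
  linarith

/-- Weights are distinct positive integers. This bound, attained by the lightest coins, is what
turns a balance into a lower bound on a single coin. -/
lemma card_mul_le_two_mul_sum_weight {n : ℕ} (σ : Arrangement n) (s : Finset (Fin n)) :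
    s.card * (s.card + 1) ≤ 2 * ∑ c ∈ s, weight σ c := by
  have hinj : Function.Injective fun c : Fin n => (weight σ c : ℤ) := fun c d h => by
    apply σ.injective
    apply Fin.ext
    simpa [weight] using h
  have h := Finset.sum_range_le_sum (s := s.map ⟨_, hinj⟩) (c := 1) (by simp [weight])
  rw [Finset.card_map, Finset.sum_map] at h
  have h2 := Finset.sum_range_id_mul_two (s.card + 1)
  rw [Finset.sum_range_succ'] at h2
  simp only [add_zero, Nat.add_sub_cancel] at h2
  have h3 : ∑ i ∈ Finset.range s.card, (i + 1) ≤ ∑ c ∈ s, weight σ c := by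
    have h' : ∑ i ∈ Finset.range s.card, ((i : ℤ) + 1) ≤ ∑ c ∈ s, (weight σ c : ℤ) := by
      simpa [add_comm] using h
    exact_mod_cast h'
  linarith

lemma exists_weight_eq {n : ℕ} (τ : Arrangement n) {k : ℕ} (hk : 1 ≤ k) (hkn : k ≤ n) :
    ∃ c, weight τ c = k :=
  ⟨τ.symm ⟨k - 1, by omega⟩, by simp [weight]; omega⟩

lemma weight_pos {n : ℕ} (τ : Arrangement n) (c : Fin n) : 1 ≤ weight τ c :=
  Nat.le_add_left _ _

lemma weight_le {n : ℕ} (τ : Arrangement n) (c : Fin n) : weight τ c ≤ n :=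
  (τ c).isLt

/-- The weighing that leaves both cups empty. -/
def Weighing.empty (n : ℕ) : Weighing n := ⟨∅, ∅, Finset.disjoint_empty_left _⟩

lemma Weighing.sum_eq_of_outcome_eq {n : ℕ} {w : Weighing n} {σ τ : Arrangement n}
    (h : w.outcome σ = w.outcome τ)
    (hτ : ∑ c ∈ w.left, weight τ c = ∑ c ∈ w.right, weight τ c) :
    ∑ c ∈ w.left, weight σ c = ∑ c ∈ w.right, weight σ c := by
  rw [outcome, outcome, hτ, compare_eq_iff_eq.2 rfl] at h
  exact compare_eq_iff_eq.1 h

/-- One weighing, balancing the `a` lightest coins against a single coin, shows that the latter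
weighs at least the `a`-th triangular number. -/
lemma exists_weighing_triangular {n : ℕ} (τ : Arrangement n) {a : ℕ} (ha : 1 ≤ a)
    (han : a * (a + 1) ≤ 2 * n) : ∃ (w : Weighing n) (x : Fin n), 2 * weight τ x = a * (a + 1) ∧
      ∀ σ : Arrangement n, w.outcome σ = w.outcome τ → a * (a + 1) ≤ 2 * weight σ x := by
  obtain ⟨k, hk⟩ : ∃ k, a * (a + 1) = 2 * k := (Nat.even_mul_succ_self a).two_dvd
  obtain ⟨x, hx⟩ := exists_weight_eq τ (k := k) (by nlinarith) (by omega)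
  -- For `a = 1` the same coin would lie on both cups, but the bound is then trivial.
  rcases ha.eq_or_lt with rfl | ha2
  · refine ⟨Weighing.empty n, x, by omega, fun σ _ => ?_⟩
    have := weight_pos σ x
    omega
  have hak : a < k := by nlinarith
  have hb : a ≤ n := by omega
  let w : Weighing n := ⟨lightest τ hb, {x}, Finset.disjoint_singleton_right.2 fun h => by
    have := weight_le_of_mem_lightest h
    omega⟩
  refine ⟨w, x, by omega, fun σ hσ => ?_⟩
  have h1 := Weighing.sum_eq_of_outcome_eq hσ (by
    have := two_mul_sum_weight_lightest τ hb
    simp only [w, Finset.sum_singleton]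
    omega)
  simp only [w, Finset.sum_singleton] at h1
  have h2 := card_mul_le_two_mul_sum_weight σ (lightest τ hb)
  rw [card_lightest] at h2
  omega

/-- One weighing, balancing a coin `x` and the `b` lightest coins against a single coin `y`, shows
that the difference of the weights of `y` and `x` is at least the `b`-th triangular number. -/
lemma exists_weighing_add_triangular {n : ℕ} (τ : Arrangement n) (x : Fin n) {b : ℕ}
    (hbx : b < weight τ x) (hbn : 2 * weight τ x + b * (b + 1) ≤ 2 * n) :
    ∃ (w : Weighing n) (y : Fin n), 2 * weight τ y = 2 * weight τ x + b * (b + 1) ∧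
      ∀ σ : Arrangement n, w.outcome σ = w.outcome τ →
        2 * weight σ x + b * (b + 1) ≤ 2 * weight σ y := by
  -- For `b = 0` the coin `y` is `x` itself, so nothing needs weighing.
  rcases b.eq_zero_or_pos with rfl | hb0
  · exact ⟨Weighing.empty n, x, by simp, fun σ _ => by simp⟩
  obtain ⟨k, hk⟩ : ∃ k, b * (b + 1) = 2 * k := (Nat.even_mul_succ_self b).two_dvd
  have hk0 : 0 < k := by nlinarith
  obtain ⟨y, hy⟩ := exists_weight_eq τ (k := weight τ x + k) (by omega) (by omega)
  have hb : b ≤ n := hbx.le.trans (weight_le τ x)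
  have hx : x ∉ lightest τ hb := fun h => by
    have := weight_le_of_mem_lightest h
    omega
  let w : Weighing n := ⟨insert x (lightest τ hb), {y}, Finset.disjoint_singleton_right.2 fun h => by
    rcases Finset.mem_insert.1 h with rfl | h
    · omega
    · have := weight_le_of_mem_lightest h
      omega⟩
  refine ⟨w, y, by omega, fun σ hσ => ?_⟩
  have h1 := Weighing.sum_eq_of_outcome_eq hσ (by
    have := two_mul_sum_weight_lightest τ hb
    simp only [w, Finset.sum_singleton, Finset.sum_insert hx]
    omega)
  simp only [w, Finset.sum_singleton, Finset.sum_insert hx] at h1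
  have h2 := card_mul_le_two_mul_sum_weight σ (lightest τ hb)
  rw [card_lightest] at h2
  omega

/-! ### Chaining the weighings, and small cases -/

/-- The inequalities on `b` and `c` keep the coin carried over from the previous weighing out of the
group of lightest coins added to it. -/
lemma canDemonstrate_of_triangular_sum {n a b c : ℕ} (ha : 1 ≤ a) (hb : 2 * b < a * (a + 1))
    (hc : 2 * c < a * (a + 1) + b * (b + 1))
    (h : a * (a + 1) + b * (b + 1) + c * (c + 1) = 2 * n) : CanDemonstrate n 3 := by
  intro τ
  obtain ⟨w₁, x, hx, hx'⟩ := exists_weighing_triangular τ ha (by omega)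
  obtain ⟨w₂, y, hy, hy'⟩ := exists_weighing_add_triangular τ x (b := b) (by omega) (by omega)
  obtain ⟨w₃, z, hz, hz'⟩ := exists_weighing_add_triangular τ y (b := c) (by omega) (by omega)
  refine ⟨![w₁, w₂, w₃], z, fun σ hσ => ?_⟩
  have h₁ := hx' σ (hσ 0)
  have h₂ := hy' σ (hσ 1)
  have h₃ := hz' σ (hσ 2)
  have := weight_le σ z
  omega

lemma canDemonstrate_two : CanDemonstrate 2 3 := by
  intro τ
  refine ⟨fun _ => ⟨{τ.symm 0}, {τ.symm 1}, by simp⟩, τ.symm 0, fun σ hσ => ?_⟩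
  have h : weight σ (τ.symm 0) < weight σ (τ.symm 1) := by
    have h0 := hσ 0
    simp only [Weighing.outcome, Finset.sum_singleton] at h0
    rw [compare_lt_iff_lt.2 (by simp [weight] : weight τ (τ.symm 0) < weight τ (τ.symm 1))] at h0
    exact compare_lt_iff_lt.1 h0
  have h1 := weight_le σ (τ.symm 1)
  have h2 := weight_pos σ (τ.symm 0)
  have h3 : weight τ (τ.symm 0) = 1 := by simp [weight]
  omega

lemma exists_antitone_triangular_sum_eq (n : ℕ) :
    ∃ a b c : ℕ, c ≤ b ∧ b ≤ a ∧ a * (a + 1) + b * (b + 1) + c * (c + 1) = 2 * n := by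
  obtain ⟨a, b, c, h⟩ := exists_triangular_sum_eq n
  rcases le_total a b with h1 | h1 <;> rcases le_total b c with h2 | h2 <;>
    rcases le_total a c with h3 | h3
  · exact ⟨c, b, a, h1, h2, by omega⟩
  · exact ⟨c, b, a, h1, h2, by omega⟩
  · exact ⟨b, c, a, h3, h2, by omega⟩
  · exact ⟨b, a, c, h3, h1, by omega⟩
  · exact ⟨c, a, b, h1, h3, by omega⟩
  · exact ⟨a, c, b, h2, h3, by omega⟩
  · exact ⟨a, b, c, h2, h1, by omega⟩
  · exact ⟨a, b, c, h2, h1, by omega⟩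

lemma canDemonstrate_three {n : ℕ} (hn : 1 ≤ n) : CanDemonstrate n 3 := by
  obtain ⟨a, b, c, hcb, hba, h⟩ := exists_antitone_triangular_sum_eq n
  rcases (by omega : a = 0 ∨ a = 1 ∨ 2 ≤ a) with rfl | rfl | ha
  · obtain rfl : b = 0 := by omega
    obtain rfl : c = 0 := by omega
    omega
  -- With `a = b = 1` the carried coin is itself the lightest one, so the chain breaks down: `2 = 1
  -- + 1` is replaced by a direct comparison, and `3 = 1 + 1 + 1` by `3 = T_2`.
  · have hn3 : n ≤ 3 := by nlinarith
    obtain rfl | rfl | rfl : n = 1 ∨ n = 2 ∨ n = 3 := by omega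
    · exact canDemonstrate_of_triangular_sum (a := 1) (b := 0) (c := 0) le_rfl (by simp) (by simp)
        (by simp)
    · exact canDemonstrate_two
    · exact canDemonstrate_of_triangular_sum (a := 2) (b := 0) (c := 0) (by simp) (by simp)
        (by simp) (by simp)
  · exact canDemonstrate_of_triangular_sum (by omega) (by nlinarith) (by nlinarith) h

end Munchhausen

theorem theorem1 (n : ℕ) (hn : 1 ≤ n) : Munchhausen.a n ≤ 3 := by
  exact iInf₂_le 3 (Munchhausen.canDemonstrate_three hn)
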